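/- Let $X$, $\mathcal B$ and $\mathcal K$ be Hilbert spaces (over the same field, $\mathbb R$ or $\mathbb C$). An operator $S$ on $X$ with domain $\mathrm{dom}(S)$ is called dissipative if $\mathrm{Re}\langle x,Sx\rangle\le 0$ for all $x\in\mathrm{dom}(S)$, and skew-symmetric if $\mathrm{Re}\langle x,Sx\rangle=0$ for all $x\in\mathrm{dom}(S)$. Let $A_0$ be a densely defined, skew-symmetric and closed linear operator on $X$, and let $(\mathcal B;B_1,B_2)$ be a boundary triplet for $A_0^*$; that is, $B_1,B_2:\mathrm{dom}(A_0^*)\to\mathcal B$ are linear and bounded with respect to the graph norm of $A_0^*$, the map $x\mapsto(B_1x,B_2x)$ from $\mathrm{dom}(A_0^*)$ to $\mathcal B\times\mathcal B$ is surjective, and $$\langle A_0^*x,\tilde x\rangle_X+\langle x,A_0^*\tilde x\rangle_X=\langle B_1x,B_2\tilde x\rangle_{\mathcal B}+\langle B_2x,B_1\tilde x\rangle_{\mathcal B}\qquad\text{for all }x,\tilde x\in\mathrm{dom}(A_0^*).$$ Let $W_1,W_2:\mathcal B\to\mathcal K$ be bounded linear operators, and let $A$ be the restriction of $A_0^*$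 to $\mathrm{dom}(A)=\{x\in\mathrm{dom}(A_0^*) : W_1B_1x+W_2B_2x=0\}$. Assume that $\mathrm{ran}(W_1-W_2)\subseteq\mathrm{ran}(W_1+W_2)$. Then the following conditions are equivalent: 1. $A$ generates a contraction semigroup on $X$ (i.e. $A$ is the infinitesimal generator of a strongly continuous semigroup of contractions on $X$); 2. $A$ is dissipative; 3. $W_1+W_2$ is injective and $W_1W_2^*+W_2W_1^*\ge 0$ in $\mathcal K$. -/

import Mathlib

open Filter Topology
open scoped NNReal LinearPMap InnerProductSpace

/-- A (linear) relation `R` in `X`, i.e. a subspace of `X × X`, is dissipative if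
`Re ⟪r₁, r₂⟫ ≤ 0` for all `(r₁, r₂) ∈ R`. -/
def RelIsDissipative {𝕜 X : Type*} [RCLike 𝕜] [NormedAddCommGroup X] [InnerProductSpace 𝕜 X]
    (R : Submodule 𝕜 (X × X)) : Prop :=
  ∀ r ∈ R, RCLike.re (inner 𝕜 r.1 r.2) ≤ 0

/-- A relation `R` is skew-symmetric if `Re ⟪r₁, r₂⟫ = 0` for all `(r₁, r₂) ∈ R`. -/
def RelIsSkewSymmetric {𝕜 X : Type*} [RCLike 𝕜] [NormedAddCommGroup X] [InnerProductSpace 𝕜 X]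
    (R : Submodule 𝕜 (X × X)) : Prop :=
  ∀ r ∈ R, RCLike.re (inner 𝕜 r.1 r.2) = 0

/-- An operator is dissipative if its graph is. -/
def OpIsDissipative {𝕜 X : Type*} [RCLike 𝕜] [NormedAddCommGroup X] [InnerProductSpace 𝕜 X]
    (A : X →ₗ.[𝕜] X) : Prop :=
  RelIsDissipative A.graph

/-- An operator is skew-symmetric if its graph is. -/
def OpIsSkewSymmetric {𝕜 X : Type*} [RCLike 𝕜] [NormedAddCommGroup X] [InnerProductSpace 𝕜 X]
    (A : X →ₗ.[𝕜] X) : Prop :=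
  RelIsSkewSymmetric A.graph

/-- The graph norm of an operator on its domain. -/
noncomputable def graphNorm {𝕜 X : Type*} [RCLike 𝕜] [NormedAddCommGroup X]
    [InnerProductSpace 𝕜 X] (A : X →ₗ.[𝕜] X) (x : A.domain) : ℝ :=
  Real.sqrt (‖(x : X)‖ ^ 2 + ‖A x‖ ^ 2)

/-- `(𝓑; B₁, B₂)` is a boundary triplet for `A₀†`, where `A₀` is a densely defined,
skew-symmetric, closed operator on the Hilbert space `X`: `B₁, B₂ : dom A₀† → 𝓑` are linear and
bounded with respect to the graph norm, they are jointly onto `𝓑 × 𝓑`, and Green's identity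
holds. -/
structure IsBoundaryTriplet {𝕜 X 𝓑 : Type*} [RCLike 𝕜]
    [NormedAddCommGroup X] [InnerProductSpace 𝕜 X] [CompleteSpace X]
    [NormedAddCommGroup 𝓑] [InnerProductSpace 𝕜 𝓑] [CompleteSpace 𝓑]
    (A₀ : X →ₗ.[𝕜] X) (B₁ B₂ : A₀†.domain →ₗ[𝕜] 𝓑) : Prop where
  denselyDefined : Dense (A₀.domain : Set X)
  skewSymmetric : OpIsSkewSymmetric A₀
  closed : A₀.IsClosed
  bounded₁ : ∃ C : ℝ, ∀ x, ‖B₁ x‖ ≤ C * graphNorm A₀† x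
  bounded₂ : ∃ C : ℝ, ∀ x, ‖B₂ x‖ ≤ C * graphNorm A₀† x
  surjective : Function.Surjective fun x => (B₁ x, B₂ x)
  green : ∀ x y : A₀†.domain,
    inner 𝕜 (A₀† x) (y : X) + inner 𝕜 (x : X) (A₀† y)
      = inner 𝕜 (B₁ x) (B₂ y) + inner 𝕜 (B₂ x) (B₁ y)

/-- The restriction of `A₀†` to `{x ∈ dom A₀† | W₁ B₁ x + W₂ B₂ x = 0}`. -/
noncomputable def boundaryRestriction {𝕜 X 𝓑 K : Type*} [RCLike 𝕜]
    [NormedAddCommGroup X] [InnerProductSpace 𝕜 X] [CompleteSpace X]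
    [NormedAddCommGroup 𝓑] [InnerProductSpace 𝕜 𝓑]
    [NormedAddCommGroup K] [InnerProductSpace 𝕜 K]
    (A₀ : X →ₗ.[𝕜] X) (B₁ B₂ : A₀†.domain →ₗ[𝕜] 𝓑) (W₁ W₂ : 𝓑 →L[𝕜] K) : X →ₗ.[𝕜] X :=
  A₀†.domRestrict
    ((LinearMap.ker ((W₁ : 𝓑 →ₗ[𝕜] K) ∘ₗ B₁ + (W₂ : 𝓑 →ₗ[𝕜] K) ∘ₗ B₂)).map A₀†.domain.subtype)

theorem mem_boundaryRestriction_domain {𝕜 X 𝓑 K : Type*} [RCLike 𝕜]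
    [NormedAddCommGroup X] [InnerProductSpace 𝕜 X] [CompleteSpace X]
    [NormedAddCommGroup 𝓑] [InnerProductSpace 𝕜 𝓑]
    [NormedAddCommGroup K] [InnerProductSpace 𝕜 K]
    (A₀ : X →ₗ.[𝕜] X) (B₁ B₂ : A₀†.domain →ₗ[𝕜] 𝓑) (W₁ W₂ : 𝓑 →L[𝕜] K) (x : X) :
    x ∈ (boundaryRestriction A₀ B₁ B₂ W₁ W₂).domain ↔
      ∃ h : x ∈ A₀†.domain, W₁ (B₁ ⟨x, h⟩) + W₂ (B₂ ⟨x, h⟩) = 0 := by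
  simp only [boundaryRestriction, LinearPMap.domRestrict_domain, Submodule.mem_inf,
    Submodule.mem_map, LinearMap.mem_ker]
  constructor
  · rintro ⟨⟨y, hy, rfl⟩, h⟩
    exact ⟨h, hy⟩
  · rintro ⟨h, hx⟩
    exact ⟨⟨⟨x, h⟩, hx, rfl⟩, h⟩

/-- A strongly continuous semigroup of contractions on `X`. -/
structure IsContractionSemigroup {𝕜 X : Type*} [RCLike 𝕜] [NormedAddCommGroup X]
    [InnerProductSpace 𝕜 X] (T : ℝ≥0 → X →L[𝕜] X) : Prop where
  map_zero : T 0 = ContinuousLinearMap.id 𝕜 X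
  map_add : ∀ s t, T (s + t) = (T s).comp (T t)
  strongly_continuous : ∀ x, Tendsto (fun t => T t x) (𝓝[>] 0) (𝓝 x)
  contraction : ∀ t, ‖T t‖ ≤ 1

/-- `A` is the infinitesimal generator of `T`: `x ∈ dom A` with `A x = y` if and only if
`(T t x - x) / t → y` as `t ↓ 0`. -/
def IsGenerator {𝕜 X : Type*} [RCLike 𝕜] [NormedAddCommGroup X] [InnerProductSpace 𝕜 X]
    (A : X →ₗ.[𝕜] X) (T : ℝ≥0 → X →L[𝕜] X) : Prop :=
  ∀ x y : X, (x, y) ∈ A.graph ↔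
    Tendsto (fun t : ℝ≥0 => ((t : ℝ) : 𝕜)⁻¹ • (T t x - x)) (𝓝[>] 0) (𝓝 y)

/-- `A` generates a (strongly continuous) contraction semigroup on `X`. -/
def GeneratesContractionSemigroup {𝕜 X : Type*} [RCLike 𝕜] [NormedAddCommGroup X]
    [InnerProductSpace 𝕜 X] (A : X →ₗ.[𝕜] X) : Prop :=
  ∃ T : ℝ≥0 → X →L[𝕜] X, IsContractionSemigroup T ∧ IsGenerator A T

/-!
Put `V = W₁ + W₂`, `U = W₁ - W₂`. After the substitution `b₁ = c - b`, `b₂ = c + b`, the boundary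
condition `W₁ b₁ + W₂ b₂ = 0` reads `V c = U b`, and the boundary form `Re ⟪b₁, b₂⟫` becomes
`‖c‖ ^ 2 - ‖b‖ ^ 2`. By Green's identity and the surjectivity of the boundary maps, `A` is therefore
dissipative if and only if `V c = U b` implies `‖c‖ ≤ ‖b‖`
(`IsBoundaryTriplet.opIsDissipative_iff`, `forall_re_inner_nonpos_iff`).
On the other side, `W₁ W₂* + W₂ W₁* ≥ 0` means `‖U* k‖ ≤ ‖V* k‖` for all `k`. Under `ran U ⊆ ran V`
the two inequalities are dual to each other: both follow by testing `⟪c, V* k⟫ = ⟪b, U* k⟫`, where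
one direction uses that `V*` has dense range, i.e. that `V` is injective
(`forall_norm_le_iff`).

Generators of contraction semigroups are dissipative by differentiating at `0`. For the converse,
`A` extends `-A₀`, hence is densely defined, and it is closed because the boundary maps are
continuous for the graph norm. So `l - A` has closed range for `l > 0`, and a vector `y` orthogonal
to the range satisfies `A₀† y = -l y` and an adjoint boundary condition, which forces
`Re ⟪y, A₀† y⟫ ≥ 0` and thus `y = 0` (`IsBoundaryTriplet.eq_zero_of_orthogonal`). The semigroup is
then obtained from the Lumer–Phillips theorem
(`OpIsDissipative.generatesContractionSemigroup`): the bounded Yosida approximations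
`n (n (n - A)⁻¹ - 1)` commute, generate contraction semigroups, and converge to `A` on its domain,
so that their semigroups converge strongly.
-/

/-! ### Exponentials of commuting bounded operators -/

section Exponential

open NormedSpace

/-- The mean value inequality along the path `s ↦ exp ((1 - s) a) exp (s b)` from `exp a` to
`exp b`. The functional `φ` is used below as evaluation of operators at a vector. -/
theorem norm_map_exp_sub_exp_le {𝔸 E : Type*} [NormedRing 𝔸] [NormedAlgebra ℝ 𝔸]
    [CompleteSpace 𝔸] [NormedAddCommGroup E] [NormedSpace ℝ E] (φ : 𝔸 →L[ℝ] E) {a b : 𝔸}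
    (hab : Commute a b) {C : ℝ}
    (h : ∀ s : ℝ, 0 ≤ s → s ≤ 1 → ‖φ (exp ((1 - s) • a) * exp (s • b) * (b - a))‖ ≤ C) :
    ‖φ (exp b) - φ (exp a)‖ ≤ C := by
  have hd : ∀ s : ℝ, HasDerivAt (fun s : ℝ => exp ((1 - s) • a) * exp (s • b))
      (exp ((1 - s) • a) * exp (s • b) * (b - a)) s := by
    intro s
    have h1 : HasDerivAt (fun s : ℝ => exp ((1 - s) • a)) (-(exp ((1 - s) • a) * a)) s := by
      have := (hasDerivAt_exp_smul_const (𝕂 := ℝ) a (1 - s)).scomp s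
        ((hasDerivAt_const s (1 : ℝ)).sub (hasDerivAt_id s))
      simpa [Function.comp_def] using this
    have h2 := hasDerivAt_exp_smul_const (𝕂 := ℝ) b s
    refine (h1.mul h2).congr_deriv ?_
    have hc : a * exp (s • b) = exp (s • b) * a := (hab.smul_right s).exp_right.eq
    rw [mul_sub, neg_mul, mul_assoc _ a, hc]
    simp only [mul_assoc]
    abel
  have := norm_image_sub_le_of_norm_deriv_le_segment_01' (C := C)
    (f := fun s : ℝ => φ (exp ((1 - s) • a) * exp (s • b)))
    (fun s _ => ((φ.hasFDerivAt.comp_hasDerivAt s (hd s)).hasDerivWithinAt))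
    (fun s hs => h s hs.1 hs.2.le)
  simpa using this

/-- The mean value inequality for `s ↦ exp (s a) - s a`, after applying a functional `φ`. -/
theorem norm_map_exp_sub_one_sub_le {𝔸 E : Type*} [NormedRing 𝔸] [NormedAlgebra ℝ 𝔸]
    [CompleteSpace 𝔸] [NormedAddCommGroup E] [NormedSpace ℝ E] (φ : 𝔸 →L[ℝ] E) {a : 𝔸}
    {C : ℝ} (h : ∀ s : ℝ, 0 ≤ s → s ≤ 1 → ‖φ (exp (s • a) * a) - φ a‖ ≤ C) :
    ‖φ (exp a) - φ 1 - φ a‖ ≤ C := by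
  have hd : ∀ s : ℝ, HasDerivAt (fun s : ℝ => φ (exp (s • a)) - s • φ a)
      (φ (exp (s • a) * a) - φ a) s := fun s => by
    have h1 : HasDerivAt (fun s : ℝ => φ (exp (s • a))) (φ (exp (s • a) * a)) s :=
      φ.hasFDerivAt.comp_hasDerivAt s (hasDerivAt_exp_smul_const (𝕂 := ℝ) a s)
    have h2 : HasDerivAt (fun s : ℝ => s • φ a) (φ a) s := by
      simpa using (hasDerivAt_id s).smul_const (φ a)
    exact h1.sub h2
  have := norm_image_sub_le_of_norm_deriv_le_segment_01' (C := C)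
    (fun s _ => (hd s).hasDerivWithinAt) (fun s hs => h s hs.1 hs.2.le)
  rw [sub_right_comm]
  simpa using this

theorem norm_exp_le_exp_norm {𝔸 : Type*} [NormedRing 𝔸] [NormedAlgebra ℝ 𝔸] [CompleteSpace 𝔸]
    (h1 : ‖(1 : 𝔸)‖ ≤ 1) (a : 𝔸) : ‖exp a‖ ≤ Real.exp ‖a‖ := by
  have hpow : ∀ n : ℕ, ‖a ^ n‖ ≤ ‖a‖ ^ n := fun n => by
    rcases n.eq_zero_or_pos with rfl | hn
    · simpa using h1
    · exact norm_pow_le' a hn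
  have hsum : HasSum (fun n : ℕ => ((n.factorial : ℝ)⁻¹) • ‖a‖ ^ n) (Real.exp ‖a‖) := by
    rw [Real.exp_eq_exp_ℝ]
    exact exp_series_hasSum_exp' (𝕂 := ℝ) ‖a‖
  rw [exp_eq_tsum ℝ]
  refine tsum_of_norm_bounded hsum fun n => ?_
  rw [norm_smul, norm_inv, Real.norm_natCast, smul_eq_mul]
  gcongr
  exact hpow n

theorem norm_exp_smul_sub_one_le {𝔸 : Type*} [NormedRing 𝔸] [NormedAlgebra ℝ 𝔸]
    [CompleteSpace 𝔸] (h1 : ‖(1 : 𝔸)‖ ≤ 1) {a : 𝔸} (ha : ‖a‖ ≤ 1) {s : ℝ} (hs : 0 ≤ s) :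
    ‖exp (s • (a - 1))‖ ≤ 1 := by
  let _ : NormedAlgebra ℚ 𝔸 := NormedAlgebra.restrictScalars ℚ ℝ 𝔸
  have h : s • (a - 1) = algebraMap ℝ 𝔸 (-s) + s • a := by
    rw [map_neg, Algebra.algebraMap_eq_smul_one, smul_sub]
    abel
  rw [h, exp_add_of_commute (Algebra.commute_algebraMap_left _ _), ← algebraMap_exp_comm,
    ← Algebra.smul_def, norm_smul, ← Real.exp_eq_exp_ℝ, Real.norm_of_nonneg (Real.exp_nonneg _)]
  calc Real.exp (-s) * ‖exp (s • a)‖ ≤ Real.exp (-s) * Real.exp s := by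
        gcongr
        refine (norm_exp_le_exp_norm h1 _).trans (Real.exp_le_exp.2 ?_)
        rw [norm_smul, Real.norm_of_nonneg hs]
        exact mul_le_of_le_one_right hs ha
    _ = 1 := by rw [← Real.exp_add, neg_add_cancel, Real.exp_zero]

variable {𝕜 X : Type*} [RCLike 𝕜] [NormedAddCommGroup X] [NormedSpace 𝕜 X]
  [CompleteSpace X]

/-- If commuting bounded operators `a` and `b` both generate contraction semigroups, then
`‖exp (t b) x - exp (t a) x‖ ≤ t ‖b x - a x‖`. -/
theorem norm_exp_smul_apply_sub_le {a b : X →L[𝕜] X} (hab : Commute a b)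
    (ha : ∀ s : ℝ, 0 ≤ s → ‖exp ((s : 𝕜) • a)‖ ≤ 1)
    (hb : ∀ s : ℝ, 0 ≤ s → ‖exp ((s : 𝕜) • b)‖ ≤ 1) {t : ℝ} (ht : 0 ≤ t) (x : X) :
    ‖exp ((t : 𝕜) • b) x - exp ((t : 𝕜) • a) x‖ ≤ t * ‖b x - a x‖ := by
  let _ : NormedSpace ℝ X := NormedSpace.restrictScalars ℝ 𝕜 X
  let _ : NormedAlgebra ℝ (X →L[𝕜] X) := NormedAlgebra.restrictScalars ℝ 𝕜 (X →L[𝕜] X)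
  have hs : ∀ (s : ℝ) (c : X →L[𝕜] X), s • (t : 𝕜) • c = ((s * t : ℝ) : 𝕜) • c := fun s c => by
    rw [RCLike.ofReal_mul, mul_smul]; rfl
  let φ : (X →L[𝕜] X) →L[ℝ] X :=
    { toFun := fun c => c x
      map_add' := fun _ _ => rfl
      map_smul' := fun _ _ => rfl
      cont := (ContinuousLinearMap.apply 𝕜 X x).continuous }
  refine norm_map_exp_sub_exp_le φ ((hab.smul_left (t : 𝕜)).smul_right (t : 𝕜)) fun s h0 h1 => ?_
  rw [hs, hs]
  have key : φ (exp ((((1 - s) * t : ℝ) : 𝕜) • a) * exp (((s * t : ℝ) : 𝕜) • b) *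
      ((t : 𝕜) • b - (t : 𝕜) • a)) = exp ((((1 - s) * t : ℝ) : 𝕜) • a)
        (exp (((s * t : ℝ) : 𝕜) • b) ((t : 𝕜) • (b x - a x))) := by
    rw [← smul_sub]; rfl
  rw [key]
  refine ((ContinuousLinearMap.le_of_opNorm_le _ (ha _ (mul_nonneg (by linarith) ht)) _).trans
    ?_)
  rw [one_mul]
  refine ((ContinuousLinearMap.le_of_opNorm_le _ (hb _ (mul_nonneg h0 ht)) _).trans ?_)
  rw [one_mul, norm_smul, RCLike.norm_ofReal, abs_of_nonneg ht]

theorem norm_exp_smul_apply_sub_self_le {a : X →L[𝕜] X}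
    (ha : ∀ s : ℝ, 0 ≤ s → ‖exp ((s : 𝕜) • a)‖ ≤ 1) {t : ℝ} (ht : 0 ≤ t) (x : X) :
    ‖exp ((t : 𝕜) • a) x - x‖ ≤ t * ‖a x‖ := by
  have h0 : ∀ s : ℝ, 0 ≤ s → ‖exp ((s : 𝕜) • (0 : X →L[𝕜] X))‖ ≤ 1 := fun s _ => by
    rw [smul_zero, exp_zero]; exact ContinuousLinearMap.norm_id_le
  simpa using norm_exp_smul_apply_sub_le (Commute.zero_left a) h0 ha ht x

/-- A quantitative form of differentiability at `0` of the orbit of `x`, uniform in `a` as long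
as `a x` stays close to some `z` on which `a` is under control. -/
theorem norm_exp_smul_apply_sub_self_sub_le {a : X →L[𝕜] X}
    (ha : ∀ s : ℝ, 0 ≤ s → ‖exp ((s : 𝕜) • a)‖ ≤ 1) {t : ℝ} (ht : 0 ≤ t) (x z : X) :
    ‖exp ((t : 𝕜) • a) x - x - (t : 𝕜) • a x‖ ≤ t * (2 * ‖a x - z‖ + t * ‖a z‖) := by
  let _ : NormedSpace ℝ X := NormedSpace.restrictScalars ℝ 𝕜 X
  let _ : NormedAlgebra ℝ (X →L[𝕜] X) := NormedAlgebra.restrictScalars ℝ 𝕜 (X →L[𝕜] X)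
  have hs : ∀ (s : ℝ) (c : X →L[𝕜] X), s • (t : 𝕜) • c = ((s * t : ℝ) : 𝕜) • c := fun s c => by
    rw [RCLike.ofReal_mul, mul_smul]; rfl
  let φ : (X →L[𝕜] X) →L[ℝ] X :=
    { toFun := fun c => c x
      map_add' := fun _ _ => rfl
      map_smul' := fun _ _ => rfl
      cont := (ContinuousLinearMap.apply 𝕜 X x).continuous }
  refine norm_map_exp_sub_one_sub_le φ fun s h0 h1 => ?_
  rw [hs]
  set e := exp (((s * t : ℝ) : 𝕜) • a) with he
  have hst : 0 ≤ s * t := mul_nonneg h0 ht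
  have key : φ (e * ((t : 𝕜) • a)) - φ ((t : 𝕜) • a) =
      (t : 𝕜) • (e (a x - z) - (a x - z) + (e z - z)) := by
    have : φ (e * ((t : 𝕜) • a)) - φ ((t : 𝕜) • a) = e ((t : 𝕜) • a x) - (t : 𝕜) • a x := rfl
    rw [this, map_smul, ← smul_sub, map_sub]
    congr 1
    abel
  rw [key, norm_smul, RCLike.norm_ofReal, abs_of_nonneg ht]
  gcongr
  refine (norm_add_le _ _).trans (add_le_add ?_ ?_)
  · refine (norm_sub_le _ _).trans ?_
    have := ContinuousLinearMap.le_of_opNorm_le _ (ha _ hst) (a x - z)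
    rw [← he] at this
    linarith
  · refine (norm_exp_smul_apply_sub_self_le ha hst z).trans ?_
    gcongr
    nlinarith

/-- The Yosida approximation `n (a - 1)`, where `a` is `n` times the resolvent at `n`, generates
a contraction semigroup. -/
theorem norm_exp_smul_yosida_le {a : X →L[𝕜] X} (ha : ‖a‖ ≤ 1) {n : ℝ} (hn : 0 ≤ n) {s : ℝ}
    (hs : 0 ≤ s) : ‖exp ((s : 𝕜) • (n : 𝕜) • (a - 1))‖ ≤ 1 := by
  let _ : NormedAlgebra ℝ (X →L[𝕜] X) := NormedAlgebra.restrictScalars ℝ 𝕜 (X →L[𝕜] X)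
  rw [smul_smul, ← RCLike.ofReal_mul]
  exact norm_exp_smul_sub_one_le ContinuousLinearMap.norm_id_le ha (mul_nonneg hs hn)

end Exponential

/-! ### Pointwise convergence of contractions -/

section Contractions

variable {𝕜 X ι : Type*} [RCLike 𝕜] [NormedAddCommGroup X] [NormedSpace 𝕜 X]

theorem ContinuousLinearMap.norm_apply_le_of_norm_le_one {L : X →L[𝕜] X} (hL : ‖L‖ ≤ 1) (x : X) :
    ‖L x‖ ≤ ‖x‖ := by
  simpa using L.le_of_opNorm_le hL x

theorem tendsto_apply_of_norm_le_one {F : Filter ι} {L : ι → X →L[𝕜] X} (hL : ∀ i, ‖L i‖ ≤ 1)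
    {u : ι → X} {x y : X} (hu : Tendsto u F (𝓝 x)) (hx : Tendsto (fun i => L i x) F (𝓝 y)) :
    Tendsto (fun i => L i (u i)) F (𝓝 y) := by
  have h : Tendsto (fun i => L i (u i - x)) F (𝓝 0) :=
    squeeze_zero_norm (fun i => (L i).norm_apply_le_of_norm_le_one (hL i) _)
      (tendsto_iff_norm_sub_tendsto_zero.1 hu)
  simpa using h.add hx

theorem tendsto_apply_self_of_dense {F : Filter ι} {L : ι → X →L[𝕜] X} (hL : ∀ i, ‖L i‖ ≤ 1)
    {D : Set X} (hD : Dense D) (h : ∀ x ∈ D, Tendsto (fun i => L i x) F (𝓝 x)) (x : X) :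
    Tendsto (fun i => L i x) F (𝓝 x) := by
  rw [Metric.tendsto_nhds]
  intro ε hε
  obtain ⟨z, hz, hxz⟩ := hD.exists_dist_lt x (show 0 < ε / 3 by positivity)
  filter_upwards [Metric.tendsto_nhds.1 (h z hz) (ε / 3) (by positivity)] with i hi
  have h1 : dist (L i x) (L i z) ≤ dist x z := by
    rw [dist_eq_norm, dist_eq_norm, ← map_sub]
    exact (L i).norm_apply_le_of_norm_le_one (hL i) _
  have h2 := dist_triangle4_right (L i x) x (L i z) z
  have h3 := dist_triangle (L i x) (L i z) x
  have h4 := dist_triangle (L i z) z x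
  rw [dist_comm z x] at h4
  linarith

theorem cauchySeq_apply_of_dense {L : ℕ → X →L[𝕜] X} (hL : ∀ i, ‖L i‖ ≤ 1)
    {D : Set X} (hD : Dense D) (h : ∀ x ∈ D, CauchySeq (fun i => L i x)) (x : X) :
    CauchySeq (fun i => L i x) := by
  rw [Metric.cauchySeq_iff']
  intro ε hε
  obtain ⟨z, hz, hxz⟩ := hD.exists_dist_lt x (show 0 < ε / 3 by positivity)
  obtain ⟨N, hN⟩ := Metric.cauchySeq_iff'.1 (h z hz) (ε / 3) (by positivity)
  refine ⟨N, fun n hn => ?_⟩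
  have h1 : ∀ i, dist (L i x) (L i z) ≤ dist x z := fun i => by
    rw [dist_eq_norm, dist_eq_norm, ← map_sub]
    exact (L i).norm_apply_le_of_norm_le_one (hL i) _
  have h2 := dist_triangle4 (L n x) (L n z) (L N z) (L N x)
  rw [dist_comm (L N z)] at h2
  linarith [h1 n, h1 N, hN n hn]

end Contractions

/-! ### The Lumer–Phillips theorem -/

section LumerPhillips

open NormedSpace

variable {𝕜 X : Type*} [RCLike 𝕜] [NormedAddCommGroup X] [InnerProductSpace 𝕜 X]

theorem OpIsDissipative.re_inner_nonpos {A : X →ₗ.[𝕜] X} (hA : OpIsDissipative A) (x : A.domain) :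
    RCLike.re (inner 𝕜 (x : X) (A x)) ≤ 0 :=
  hA ((x : X), A x) (A.mem_graph x)

theorem OpIsDissipative.mul_norm_le {A : X →ₗ.[𝕜] X} (hA : OpIsDissipative A) (l : ℝ)
    (x : A.domain) : l * ‖(x : X)‖ ≤ ‖(l : 𝕜) • (x : X) - A x‖ := by
  rcases (norm_nonneg (x : X)).eq_or_lt with h0 | h0
  · rw [← h0, mul_zero]; exact norm_nonneg _
  refine le_of_mul_le_mul_right ?_ h0
  have h := re_inner_le_norm (𝕜 := 𝕜) (x : X) ((l : 𝕜) • (x : X) - A x)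
  rw [inner_sub_right, map_sub, inner_smul_right, RCLike.re_ofReal_mul,
    inner_self_eq_norm_sq] at h
  nlinarith [hA.re_inner_nonpos x]

/-- For a dissipative `A` with `l - A` onto, this is `J = l (l - A)⁻¹`, which is a contraction with
values in the domain of `A`, and `A J = l (J - 1)`. -/
theorem OpIsDissipative.exists_resolvent {A : X →ₗ.[𝕜] X} (hA : OpIsDissipative A) {l : ℝ}
    (hl : 0 < l) (hs : ∀ y, ∃ x : A.domain, (l : 𝕜) • (x : X) - A x = y) :
    ∃ J : X →L[𝕜] X, ‖J‖ ≤ 1 ∧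
      (∀ y, ∃ x : A.domain, (x : X) = J y ∧ A x = (l : 𝕜) • (J y - y)) ∧
      ∀ x : A.domain, J ((l : 𝕜) • (x : X) - A x) = (l : 𝕜) • (x : X) := by
  have hl' : (l : 𝕜) ≠ 0 := RCLike.ofReal_ne_zero.2 hl.ne'
  let S : A.domain →ₗ[𝕜] X := (l : 𝕜) • A.domain.subtype - A.toFun
  have hS : ∀ x, S x = (l : 𝕜) • (x : X) - A x := fun _ => rfl
  have hinj : Function.Injective S := by
    rw [injective_iff_map_eq_zero]
    intro x hx
    have h := hA.mul_norm_le l x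
    rw [← hS, hx, norm_zero] at h
    have : ‖(x : X)‖ ≤ 0 := by
      by_contra hcon
      nlinarith [mul_pos hl (not_le.1 hcon)]
    exact Subtype.ext (norm_le_zero_iff.1 this)
  let e : A.domain ≃ₗ[𝕜] X := LinearEquiv.ofBijective S ⟨hinj, hs⟩
  have he : ∀ y, S (e.symm y) = y := fun y => e.apply_symm_apply y
  have hes : ∀ x, e.symm (S x) = x := fun x => e.symm_apply_apply x
  let J₀ : X →ₗ[𝕜] X := (l : 𝕜) • (A.domain.subtype ∘ₗ e.symm.toLinearMap)
  have hJ₀ : ∀ y, J₀ y = (l : 𝕜) • (e.symm y : X) := fun _ => rfl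
  have hbound : ∀ y, ‖J₀ y‖ ≤ 1 * ‖y‖ := fun y => by
    rw [hJ₀, norm_smul, RCLike.norm_ofReal, abs_of_pos hl, one_mul]
    refine (hA.mul_norm_le l _).trans_eq ?_
    rw [← hS, he]
  refine ⟨J₀.mkContinuous 1 hbound, J₀.mkContinuous_norm_le zero_le_one _, fun y => ?_,
    fun x => ?_⟩
  · refine ⟨(l : 𝕜) • e.symm y, rfl, ?_⟩
    have h := he y
    rw [hS] at h
    have h' : A (e.symm y) = (l : 𝕜) • (e.symm y : X) - y := by
      rw [← sub_sub_cancel ((l : 𝕜) • (e.symm y : X)) (A (e.symm y)), h]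
    rw [LinearMap.mkContinuous_apply, hJ₀, A.map_smul, h']
  · rw [LinearMap.mkContinuous_apply, hJ₀, ← hS, hes]

/-- Bounded operators that commute pairwise, generate contraction semigroups, and converge
pointwise on a dense domain to `A` have semigroups which converge strongly to a contraction
semigroup, the generator of which extends `A`. -/
theorem exists_contractionSemigroup_of_tendsto [CompleteSpace X] {A : X →ₗ.[𝕜] X}
    (hd : Dense (A.domain : Set X)) {a : ℕ → X →L[𝕜] X} (hcomm : ∀ m n, Commute (a m) (a n))
    (ha : ∀ n (s : ℝ), 0 ≤ s → ‖exp ((s : 𝕜) • a n)‖ ≤ 1)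
    (hlim : ∀ x : A.domain, Tendsto (fun n => a n x) atTop (𝓝 (A x))) :
    ∃ T : ℝ≥0 → X →L[𝕜] X, IsContractionSemigroup T ∧ ∀ x : A.domain,
      Tendsto (fun t : ℝ≥0 => ((t : ℝ) : 𝕜)⁻¹ • (T t x - x)) (𝓝[>] 0) (𝓝 (A x)) := by
  have hcauchy : ∀ (t : ℝ≥0) (x : X), CauchySeq fun n => exp (((t : ℝ) : 𝕜) • a n) x := by
    intro t x
    refine cauchySeq_apply_of_dense (fun n => ha n t t.2) hd (fun z hz => ?_) x
    rw [Metric.cauchySeq_iff']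
    intro ε hε
    -- Dividing by `t + 1` rather than `t` covers `t = 0`.
    have ht : 0 < (t : ℝ) + 1 := by positivity
    obtain ⟨N, hN⟩ := Metric.cauchySeq_iff'.1 (hlim ⟨z, hz⟩).cauchySeq (ε / (t + 1))
      (by positivity)
    refine ⟨N, fun n hn => ?_⟩
    have h1 := norm_exp_smul_apply_sub_le (hcomm N n) (ha N) (ha n) t.2 z
    have h2 := hN n hn
    rw [dist_eq_norm, lt_div_iff₀ ht] at h2
    rw [dist_eq_norm]
    have : (0 : ℝ) ≤ ‖a n z - a N z‖ := norm_nonneg _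
    refine h1.trans_lt ?_
    change (t : ℝ) * _ < ε
    nlinarith
  choose f hf using fun t x => cauchySeq_tendsto_of_complete (hcauchy t x)
  let T : ℝ≥0 → X →L[𝕜] X := fun t : ℝ≥0 =>
    continuousLinearMapOfTendsto (fun n => exp (((t : ℝ) : 𝕜) • a n)) (f := f t)
      (tendsto_pi_nhds.2 (hf t))
  have hT : ∀ (t : ℝ≥0) (x : X), Tendsto (fun n => exp (((t : ℝ) : 𝕜) • a n) x) atTop (𝓝 (T t x)) := hf
  have hcontr : ∀ t, ‖T t‖ ≤ 1 := fun t =>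
    ContinuousLinearMap.opNorm_le_bound _ zero_le_one fun x =>
      le_of_tendsto (hT t x).norm <| Eventually.of_forall fun n =>
        ContinuousLinearMap.le_of_opNorm_le _ (ha n t t.2) x
  have hfirst : ∀ (t : ℝ≥0) (x : A.domain), ‖T t x - x‖ ≤ (t : ℝ) * ‖A x‖ := fun t x =>
    le_of_tendsto_of_tendsto ((hT t x).sub_const _).norm ((hlim x).norm.const_mul _) <|
      Eventually.of_forall fun n => norm_exp_smul_apply_sub_self_le (ha n) t.2 _
  have hsecond : ∀ (t : ℝ≥0) (x z : A.domain),
      ‖T t x - x - ((t : ℝ) : 𝕜) • A x‖ ≤ (t : ℝ) * (2 * ‖A x - z‖ + (t : ℝ) * ‖A z‖) := fun t x z =>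
    le_of_tendsto_of_tendsto (((hT t x).sub_const _).sub ((hlim x).const_smul _)).norm
      (((((hlim x).sub_const _).norm.const_mul _).add ((hlim z).norm.const_mul _)).const_mul _) <|
      Eventually.of_forall fun n => norm_exp_smul_apply_sub_self_sub_le (ha n) t.2 _ _
  have hcoe : Tendsto (fun t : ℝ≥0 => (t : ℝ)) (𝓝[>] 0) (𝓝 0) :=
    (NNReal.continuous_coe.tendsto' 0 0 NNReal.coe_zero).mono_left nhdsWithin_le_nhds
  refine ⟨T, ⟨?_, ?_, ?_, hcontr⟩, fun x => ?_⟩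
  · ext x
    refine tendsto_nhds_unique (hT 0 x) ?_
    simp
  · intro s t
    ext x
    refine tendsto_nhds_unique (hT (s + t) x) ?_
    have h := tendsto_apply_of_norm_le_one (fun n => ha n s s.2) (hT t x) (hT s (T t x))
    refine h.congr fun n => ?_
    let _ : NormedAlgebra ℚ (X →L[𝕜] X) := NormedAlgebra.restrictScalars ℚ 𝕜 (X →L[𝕜] X)
    rw [NNReal.coe_add, RCLike.ofReal_add, add_smul, exp_add_of_commute]
    · rfl
    · exact ((Commute.refl (a n)).smul_left _).smul_right _
  · refine tendsto_apply_self_of_dense hcontr hd fun x hx => ?_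
    rw [tendsto_iff_norm_sub_tendsto_zero]
    refine squeeze_zero (fun _ => norm_nonneg _) (fun t => hfirst t ⟨x, hx⟩) ?_
    simpa using hcoe.mul_const ‖A ⟨x, hx⟩‖
  · rw [Metric.tendsto_nhds]
    intro ε hε
    obtain ⟨z, hz, hxz⟩ := hd.exists_dist_lt (A x) (show 0 < ε / 4 by positivity)
    have hz0 : Tendsto (fun t : ℝ≥0 => (t : ℝ) * ‖A ⟨z, hz⟩‖) (𝓝[>] 0) (𝓝 0) := by
      simpa using hcoe.mul_const ‖A ⟨z, hz⟩‖
    filter_upwards [hz0.eventually_lt_const (show 0 < ε / 2 by positivity),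
      self_mem_nhdsWithin] with t h1 ht
    have ht' : 0 < (t : ℝ) := ht
    have ht0 : ((t : ℝ) : 𝕜) ≠ 0 := RCLike.ofReal_ne_zero.2 ht'.ne'
    have h2 := hsecond t x ⟨z, hz⟩
    have h3 : ((t : ℝ) : 𝕜)⁻¹ • (T t x - x) - A x =
        ((t : ℝ) : 𝕜)⁻¹ • (T t x - x - ((t : ℝ) : 𝕜) • A x) := by
      rw [smul_sub _ _ (((t : ℝ) : 𝕜) • A x), inv_smul_smul₀ ht0]
    rw [dist_eq_norm] at hxz ⊢
    rw [h3, norm_smul, norm_inv, RCLike.norm_ofReal, abs_of_pos ht', inv_mul_lt_iff₀ ht']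
    refine h2.trans_lt ?_
    gcongr
    linarith

/-- The infinitesimal generator of a contraction semigroup is dissipative. -/
theorem IsContractionSemigroup.re_inner_nonpos {T : ℝ≥0 → X →L[𝕜] X}
    (hT : IsContractionSemigroup T) {x y : X}
    (h : Tendsto (fun t : ℝ≥0 => ((t : ℝ) : 𝕜)⁻¹ • (T t x - x)) (𝓝[>] 0) (𝓝 y)) :
    RCLike.re (inner 𝕜 x y) ≤ 0 := by
  have h1 : Tendsto (fun t : ℝ≥0 => RCLike.re (inner 𝕜 x (((t : ℝ) : 𝕜)⁻¹ • (T t x - x))))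
      (𝓝[>] 0) (𝓝 (RCLike.re (inner 𝕜 x y))) :=
    (RCLike.continuous_re.tendsto _).comp (tendsto_const_nhds.inner h)
  refine le_of_tendsto h1 (Eventually.of_forall fun t => ?_)
  rw [inner_smul_right, ← RCLike.ofReal_inv, RCLike.re_ofReal_mul]
  refine mul_nonpos_of_nonneg_of_nonpos (inv_nonneg.2 t.2) ?_
  rw [inner_sub_right, map_sub, inner_self_eq_norm_sq]
  have h2 := re_inner_le_norm (𝕜 := 𝕜) x (T t x)
  have h3 := (T t).norm_apply_le_of_norm_le_one (hT.contraction t) x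
  nlinarith [norm_nonneg x]

theorem GeneratesContractionSemigroup.opIsDissipative {A : X →ₗ.[𝕜] X}
    (hA : GeneratesContractionSemigroup A) : OpIsDissipative A := by
  obtain ⟨T, hT, hgen⟩ := hA
  exact fun r hr => hT.re_inner_nonpos ((hgen r.1 r.2).1 hr)

/-- The generation part of the Lumer–Phillips theorem, by Yosida approximation. -/
theorem OpIsDissipative.generatesContractionSemigroup [CompleteSpace X] {A : X →ₗ.[𝕜] X}
    (hA : OpIsDissipative A) (hd : Dense (A.domain : Set X))
    (hs : ∀ l : ℝ, 0 < l → ∀ y, ∃ x : A.domain, (l : 𝕜) • (x : X) - A x = y) :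
    GeneratesContractionSemigroup A := by
  have hpos : ∀ n : ℕ, (0 : ℝ) < n + 1 := fun n => by positivity
  have hne : ∀ n : ℕ, (((n + 1 : ℝ)) : 𝕜) ≠ 0 := fun n => RCLike.ofReal_ne_zero.2 (hpos n).ne'
  choose J hJ1 hJ2 hJ3 using fun n : ℕ => hA.exists_resolvent (hpos n) (hs _ (hpos n))
  have hcancel : ∀ (n : ℕ) (x : A.domain) (y : X),
      A x = ((n + 1 : ℝ) : 𝕜) • ((x : X) - y) → J n y = x := by
    intro n x y h
    have := hJ3 n x
    rw [h, ← smul_sub, sub_sub_cancel, map_smul] at this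
    exact smul_right_injective X (hne n) this
  have hJA : ∀ n (x : A.domain), J n (A x) = ((n + 1 : ℝ) : 𝕜) • (J n x - x) := by
    intro n x
    have := hJ3 n x
    rw [map_sub, map_smul] at this
    rw [smul_sub, ← this]
    abel
  -- The resolvents commute, since `A` maps `J m (J n y)` both to `m (J m - 1) J n y` and
  -- to `J m A J n y`.
  have hJcomm : ∀ m n, Commute (J m) (J n) := by
    intro m n
    ext y
    obtain ⟨u, hu1, hu2⟩ := hJ2 n y
    obtain ⟨v, hv1, hv2⟩ := hJ2 m u
    have h1 : A v = ((n + 1 : ℝ) : 𝕜) • ((v : X) - J m y) := by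
      rw [hv2, ← hJA, hu2, map_smul, map_sub, hv1, hu1]
    change J m (J n y) = J n (J m y)
    rw [hcancel n v _ h1, hv1, hu1]
  have hJlim : ∀ x, Tendsto (fun n => J n x) atTop (𝓝 x) := by
    refine tendsto_apply_self_of_dense hJ1 hd fun x hx => ?_
    rw [tendsto_iff_norm_sub_tendsto_zero]
    refine squeeze_zero (g := fun n : ℕ => 1 / ((n : ℝ) + 1) * ‖A ⟨x, hx⟩‖)
      (fun _ => norm_nonneg _) (fun n => ?_) ?_
    · have h := (J n).norm_apply_le_of_norm_le_one (hJ1 n) (A ⟨x, hx⟩)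
      rw [hJA, norm_smul, RCLike.norm_ofReal, abs_of_pos (hpos n)] at h
      rw [one_div, le_inv_mul_iff₀ (hpos n)]
      exact h
    · simpa using tendsto_one_div_add_atTop_nhds_zero_nat.mul_const ‖A ⟨x, hx⟩‖
  obtain ⟨T, hT, hAT⟩ := exists_contractionSemigroup_of_tendsto hd
    (a := fun n => ((n + 1 : ℝ) : 𝕜) • (J n - 1))
    (fun m n => ((((hJcomm m n).sub_left (Commute.one_left _)).sub_right
      (Commute.one_right _)).smul_left _).smul_right _)
    (fun n s h0 => norm_exp_smul_yosida_le (hJ1 n) (hpos n).le h0)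
    (fun x => (hJlim (A x)).congr fun n => hJA n x)
  have hgraph : ∀ x y : X, (x, y) ∈ A.graph →
      Tendsto (fun t : ℝ≥0 => ((t : ℝ) : 𝕜)⁻¹ • (T t x - x)) (𝓝[>] 0) (𝓝 y) := by
    intro x y h
    obtain ⟨z, hz1, hz2⟩ := A.mem_graph_iff.1 h
    simp only at hz1 hz2
    rw [← hz1, ← hz2]
    exact hAT z
  refine ⟨T, hT, fun x y => ⟨hgraph x y, fun h => ?_⟩⟩
  -- The generator is dissipative and `1 - A` is already onto, so the generator cannot be larger.
  obtain ⟨z, hz⟩ := hs 1 one_pos (x - y)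
  rw [RCLike.ofReal_one, one_smul] at hz
  have hdiff : A z - y = (z : X) - x := by
    rw [← sub_sub_cancel (z : X) (A z), hz]
    abel
  have hlim := (hAT z).sub h
  have h1 : RCLike.re (inner 𝕜 ((z : X) - x) (A z - y)) ≤ 0 := by
    refine hT.re_inner_nonpos (hlim.congr fun t => ?_)
    rw [← smul_sub, map_sub]
    congr 1
    abel
  rw [hdiff, inner_self_eq_norm_sq] at h1
  have h2 : (z : X) - x = 0 := by
    rw [← norm_eq_zero]
    exact pow_eq_zero_iff two_ne_zero |>.1 (le_antisymm h1 (sq_nonneg _))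
  rw [A.mem_graph_iff]
  exact ⟨z, sub_eq_zero.1 h2, sub_eq_zero.1 (hdiff.trans h2)⟩

end LumerPhillips

/-! ### Contractive boundary conditions -/

section BoundaryCondition

theorem four_mul_re_inner {𝕜 E : Type*} [RCLike 𝕜] [NormedAddCommGroup E] [InnerProductSpace 𝕜 E]
    (x y : E) : 4 * RCLike.re (inner 𝕜 x y) = ‖x + y‖ ^ 2 - ‖x - y‖ ^ 2 := by
  rw [norm_add_sq (𝕜 := 𝕜), norm_sub_sq (𝕜 := 𝕜)]
  ring

variable {𝕜 𝓑 K : Type*} [RCLike 𝕜]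
  [NormedAddCommGroup 𝓑] [InnerProductSpace 𝕜 𝓑] [NormedAddCommGroup K] [InnerProductSpace 𝕜 K]

theorem apply_sub_add_apply_add (W₁ W₂ : 𝓑 →L[𝕜] K) (b c : 𝓑) :
    W₁ (c - b) + W₂ (c + b) = (W₁ + W₂) c - (W₁ - W₂) b := by
  simp only [map_sub, map_add, add_apply, sub_apply]
  abel

/-- The boundary form `Re ⟪b₁, b₂⟫` is nonpositive on the kernel of `W₁ b₁ + W₂ b₂` if and only
if the relation `(W₁ + W₂) c = (W₁ - W₂) b` is contractive. The substitution is
`b₁ = c - b`, `b₂ = c + b`. -/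
theorem forall_re_inner_nonpos_iff (W₁ W₂ : 𝓑 →L[𝕜] K) :
    (∀ b₁ b₂, W₁ b₁ + W₂ b₂ = 0 → RCLike.re (inner 𝕜 b₁ b₂) ≤ 0) ↔
      ∀ b c, (W₁ + W₂) c = (W₁ - W₂) b → ‖c‖ ≤ ‖b‖ := by
  constructor
  · intro h b c hbc
    have h1 : W₁ (c - b) + W₂ (c + b) = 0 := by
      rw [apply_sub_add_apply_add, hbc, sub_self]
    have h2 := h _ _ h1
    have h3 := four_mul_re_inner (𝕜 := 𝕜) (c - b) (c + b)
    rw [show c - b + (c + b) = (2 : 𝕜) • c by rw [two_smul]; abel,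
      show c - b - (c + b) = -((2 : 𝕜) • b) by rw [two_smul]; abel, norm_neg, norm_smul,
      norm_smul, RCLike.norm_ofNat] at h3
    refine le_of_sq_le_sq ?_ (norm_nonneg b)
    nlinarith
  · intro h b₁ b₂ hb
    have h1 : (W₁ + W₂) (b₁ + b₂) = (W₁ - W₂) (b₂ - b₁) := by
      rw [← sub_eq_zero]
      have : (W₁ + W₂) (b₁ + b₂) - (W₁ - W₂) (b₂ - b₁) = (2 : 𝕜) • (W₁ b₁ + W₂ b₂) := by
        simp only [map_sub, map_add, add_apply, sub_apply,
          two_smul]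
        abel
      rw [this, hb, smul_zero]
    have h2 := h _ _ h1
    have h3 := four_mul_re_inner (𝕜 := 𝕜) b₁ b₂
    rw [norm_sub_rev b₁] at h3
    nlinarith [norm_nonneg (b₁ + b₂)]

variable [CompleteSpace 𝓑] [CompleteSpace K]

/-- By polarization, `2 ⟪(W₁ W₂* + W₂ W₁*) k, k⟫` equals
`‖(W₁ + W₂)* k‖ ^ 2 - ‖(W₁ - W₂)* k‖ ^ 2`. -/
theorem isPositive_comp_adjoint_add_iff (W₁ W₂ : 𝓑 →L[𝕜] K) :
    (W₁ ∘L ContinuousLinearMap.adjoint W₂ + W₂ ∘L ContinuousLinearMap.adjoint W₁).IsPositive ↔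
      ∀ k, ‖ContinuousLinearMap.adjoint (W₁ - W₂) k‖ ≤
        ‖ContinuousLinearMap.adjoint (W₁ + W₂) k‖ := by
  have hsymm : ((W₁ ∘L ContinuousLinearMap.adjoint W₂ +
      W₂ ∘L ContinuousLinearMap.adjoint W₁ : K →L[𝕜] K) : K →ₗ[𝕜] K).IsSymmetric := by
    intro x y
    simp only [ContinuousLinearMap.coe_coe, add_apply,
      ContinuousLinearMap.comp_apply, inner_add_left, inner_add_right]
    rw [← W₁.adjoint_inner_right, ← W₂.adjoint_inner_right, ← W₁.adjoint_inner_left,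
      ← W₂.adjoint_inner_left, add_comm]
  have hform : ∀ k, 2 * (W₁ ∘L ContinuousLinearMap.adjoint W₂ +
      W₂ ∘L ContinuousLinearMap.adjoint W₁).reApplyInnerSelf k =
        ‖ContinuousLinearMap.adjoint (W₁ + W₂) k‖ ^ 2 -
          ‖ContinuousLinearMap.adjoint (W₁ - W₂) k‖ ^ 2 := by
    intro k
    rw [map_add, map_sub, add_apply, sub_apply,
      ← four_mul_re_inner (𝕜 := 𝕜), ContinuousLinearMap.reApplyInnerSelf_apply,
      add_apply, ContinuousLinearMap.comp_apply,
      ContinuousLinearMap.comp_apply, inner_add_left, map_add,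
      ← W₁.adjoint_inner_right, ← W₂.adjoint_inner_right,
      inner_re_symm (𝕜 := 𝕜) (ContinuousLinearMap.adjoint W₂ k)]
    ring
  rw [ContinuousLinearMap.isPositive_def, and_iff_right hsymm]
  refine forall_congr' fun k => ?_
  rw [← sq_le_sq₀ (norm_nonneg _) (norm_nonneg _)]
  have := hform k
  constructor <;> intro h <;> linarith

/-- The relation `(W₁ + W₂) c = (W₁ - W₂) b` is contractive if and only if the adjoint inequality
`‖(W₁ - W₂)* k‖ ≤ ‖(W₁ + W₂)* k‖` holds and `W₁ + W₂` is injective. -/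
theorem forall_norm_le_iff (W₁ W₂ : 𝓑 →L[𝕜] K)
    (hW : Set.range (W₁ - W₂) ⊆ Set.range (W₁ + W₂)) :
    (∀ b c, (W₁ + W₂) c = (W₁ - W₂) b → ‖c‖ ≤ ‖b‖) ↔
      Function.Injective (W₁ + W₂) ∧
        (W₁ ∘L ContinuousLinearMap.adjoint W₂ +
          W₂ ∘L ContinuousLinearMap.adjoint W₁).IsPositive := by
  rw [isPositive_comp_adjoint_add_iff]
  constructor
  · intro h
    refine ⟨(injective_iff_map_eq_zero _).2 fun c hc => ?_, fun k => ?_⟩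
    · simpa using h 0 c (by rw [hc, map_zero])
    · set b := ContinuousLinearMap.adjoint (W₁ - W₂) k with hb
      obtain ⟨c, hc⟩ := hW ⟨b, rfl⟩
      rcases (norm_nonneg b).eq_or_lt with h0 | h0
      · rw [← h0]; exact norm_nonneg _
      refine le_of_mul_le_mul_left ?_ h0
      have h1 : inner 𝕜 b b = inner 𝕜 c (ContinuousLinearMap.adjoint (W₁ + W₂) k) := by
        nth_rw 2 [hb]
        rw [ContinuousLinearMap.adjoint_inner_right, ContinuousLinearMap.adjoint_inner_right, hc]
      calc ‖b‖ * ‖b‖ = ‖inner 𝕜 b b‖ := by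
            rw [inner_self_eq_norm_sq_to_K, norm_pow, RCLike.norm_ofReal, abs_norm, sq]
        _ ≤ ‖c‖ * ‖ContinuousLinearMap.adjoint (W₁ + W₂) k‖ := h1 ▸ norm_inner_le_norm _ _
        _ ≤ _ := by gcongr; exact h b c hc
  · rintro ⟨hinj, h⟩ b c hbc
    have hdense : Dense (Set.range (ContinuousLinearMap.adjoint (W₁ + W₂))) := by
      have : (ContinuousLinearMap.adjoint (W₁ + W₂)).range.topologicalClosure = ⊤ := by
        rw [Submodule.topologicalClosure_eq_top_iff, ContinuousLinearMap.orthogonal_range,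
          ContinuousLinearMap.adjoint_adjoint]
        exact LinearMap.ker_eq_bot.2 hinj
      exact Submodule.dense_iff_topologicalClosure_eq_top.2 this
    -- Testing against the dense range of `(W₁ + W₂)*` bounds the functional `⟪c, ·⟫` by `‖b‖`.
    have hbound : ∀ w, ‖inner 𝕜 c w‖ ≤ ‖b‖ * ‖w‖ := by
      have hclosed : IsClosed {w : 𝓑 | ‖inner 𝕜 c w‖ ≤ ‖b‖ * ‖w‖} :=
        isClosed_le (by fun_prop) (by fun_prop)
      intro w
      refine hclosed.closure_subset_iff.2 ?_ (hdense w)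
      rintro _ ⟨k, rfl⟩
      rw [Set.mem_ofPred_eq, ContinuousLinearMap.adjoint_inner_right, hbc,
        ← ContinuousLinearMap.adjoint_inner_right]
      refine (norm_inner_le_norm _ _).trans ?_
      gcongr
      exact h k
    have := hbound c
    rcases (norm_nonneg c).eq_or_lt with h0 | h0
    · rw [← h0]; exact norm_nonneg _
    · rw [inner_self_eq_norm_sq_to_K, norm_pow, RCLike.norm_ofReal, abs_norm, sq] at this
      exact le_of_mul_le_mul_right this h0

end BoundaryCondition

/-! ### Skew-symmetric operators and graph norms -/

section SkewSymmetric

variable {𝕜 X 𝓑 : Type*} [RCLike 𝕜] [NormedAddCommGroup X] [InnerProductSpace 𝕜 X]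
  [NormedAddCommGroup 𝓑] [InnerProductSpace 𝕜 𝓑]

/-- Polarization of skew-symmetry. -/
theorem OpIsSkewSymmetric.inner_add_inner_eq_zero {S : X →ₗ.[𝕜] X} (hS : OpIsSkewSymmetric S)
    (x y : S.domain) : inner 𝕜 (S x) (y : X) + inner 𝕜 (x : X) (S y) = 0 := by
  have hre : ∀ x y : S.domain,
      RCLike.re (inner 𝕜 (S x) (y : X)) + RCLike.re (inner 𝕜 (x : X) (S y)) = 0 := by
    intro x y
    have hz : ∀ z : S.domain, RCLike.re (inner 𝕜 (z : X) (S z)) = 0 := fun z =>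
      hS (z, S z) (S.mem_graph z)
    have h := hz (x + y)
    rw [S.map_add, Submodule.coe_add, inner_add_left, inner_add_right, inner_add_right, map_add,
      map_add, map_add, hz x, hz y, inner_re_symm (𝕜 := 𝕜) (y : X)] at h
    linarith
  -- The imaginary part is the real part with `x` replaced by `I • x`.
  refine RCLike.ext (by simpa using hre x y) ?_
  have h := hre ((RCLike.I : 𝕜) • x) y
  rw [S.map_smul, Submodule.coe_smul, inner_smul_left, inner_smul_left] at h
  simp only [RCLike.conj_I, neg_mul, map_neg, RCLike.I_mul_re, neg_neg] at h
  simpa using h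

theorem tendsto_of_le_graphNorm {A : X →ₗ.[𝕜] X} {B : A.domain →ₗ[𝕜] 𝓑} {C : ℝ}
    (hB : ∀ x, ‖B x‖ ≤ C * graphNorm A x) {u : ℕ → A.domain} {x : A.domain}
    (hu : Tendsto (fun n => (u n : X)) atTop (𝓝 x))
    (hAu : Tendsto (fun n => A (u n)) atTop (𝓝 (A x))) :
    Tendsto (fun n => B (u n)) atTop (𝓝 (B x)) := by
  rw [tendsto_iff_norm_sub_tendsto_zero] at hu hAu ⊢
  refine squeeze_zero (fun _ => norm_nonneg _)
    (g := fun n => C * √(‖(u n : X) - x‖ ^ 2 + ‖A (u n) - A x‖ ^ 2)) (fun n => ?_) ?_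
  · have := hB (u n - x)
    rwa [map_sub, graphNorm, A.map_sub] at this
  · simpa using (((hu.pow 2).add (hAu.pow 2)).sqrt).const_mul C

end SkewSymmetric

/-! ### The restriction defined by a boundary condition -/

section BoundaryRestriction

variable {𝕜 X 𝓑 K : Type*} [RCLike 𝕜]
  [NormedAddCommGroup X] [InnerProductSpace 𝕜 X] [CompleteSpace X]
  [NormedAddCommGroup 𝓑] [InnerProductSpace 𝕜 𝓑]
  [NormedAddCommGroup K] [InnerProductSpace 𝕜 K]

theorem mem_boundaryRestriction_graph (A₀ : X →ₗ.[𝕜] X) (B₁ B₂ : A₀†.domain →ₗ[𝕜] 𝓑)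
    (W₁ W₂ : 𝓑 →L[𝕜] K) (x y : X) :
    (x, y) ∈ (boundaryRestriction A₀ B₁ B₂ W₁ W₂).graph ↔
      ∃ z : A₀†.domain, W₁ (B₁ z) + W₂ (B₂ z) = 0 ∧ (z : X) = x ∧ A₀† z = y := by
  rw [LinearPMap.mem_graph_iff]
  constructor
  · rintro ⟨z, rfl, rfl⟩
    obtain ⟨h, hz⟩ := (mem_boundaryRestriction_domain A₀ B₁ B₂ W₁ W₂ z).1 z.2
    exact ⟨⟨z, h⟩, hz, rfl, (LinearPMap.domRestrict_apply rfl).symm⟩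
  · rintro ⟨z, hz, rfl, rfl⟩
    exact ⟨⟨z, (mem_boundaryRestriction_domain A₀ B₁ B₂ W₁ W₂ z).2 ⟨z.2, hz⟩⟩, rfl,
      LinearPMap.domRestrict_apply rfl⟩

variable [CompleteSpace 𝓑] {A₀ : X →ₗ.[𝕜] X} {B₁ B₂ : A₀†.domain →ₗ[𝕜] 𝓑}

theorem IsBoundaryTriplet.re_inner_eq (hB : IsBoundaryTriplet A₀ B₁ B₂) (x : A₀†.domain) :
    RCLike.re (inner 𝕜 (x : X) (A₀† x)) = RCLike.re (inner 𝕜 (B₁ x) (B₂ x)) := by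
  have h := congrArg RCLike.re (hB.green x x)
  rw [map_add, map_add, inner_re_symm (𝕜 := 𝕜) (A₀† x), inner_re_symm (𝕜 := 𝕜) (B₂ x)] at h
  linarith

theorem IsBoundaryTriplet.opIsDissipative_iff (hB : IsBoundaryTriplet A₀ B₁ B₂)
    (W₁ W₂ : 𝓑 →L[𝕜] K) : OpIsDissipative (boundaryRestriction A₀ B₁ B₂ W₁ W₂) ↔
      ∀ b₁ b₂, W₁ b₁ + W₂ b₂ = 0 → RCLike.re (inner 𝕜 b₁ b₂) ≤ 0 := by
  constructor
  · intro h b₁ b₂ hb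
    obtain ⟨z, hz⟩ := hB.surjective (b₁, b₂)
    obtain ⟨rfl, rfl⟩ := Prod.mk.inj hz
    rw [← hB.re_inner_eq]
    exact h (z, A₀† z) ((mem_boundaryRestriction_graph A₀ B₁ B₂ W₁ W₂ _ _).2 ⟨z, hb, rfl, rfl⟩)
  · rintro h ⟨x, y⟩ hr
    obtain ⟨z, hz, rfl, rfl⟩ := (mem_boundaryRestriction_graph A₀ B₁ B₂ W₁ W₂ _ _).1 hr
    exact (hB.re_inner_eq z).trans_le (h _ _ hz)

/-- `A₀† x = -A₀ x` on the domain of `A₀`, where both boundary maps vanish. -/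
theorem IsBoundaryTriplet.exists_eq_neg (hB : IsBoundaryTriplet A₀ B₁ B₂) (x : A₀.domain) :
    ∃ z : A₀†.domain, (z : X) = x ∧ A₀† z = -A₀ x ∧ B₁ z = 0 ∧ B₂ z = 0 := by
  have h : ∀ y : A₀.domain, inner 𝕜 (-A₀ x) (y : X) = inner 𝕜 (x : X) (A₀ y) := fun y => by
    rw [inner_neg_left, neg_eq_iff_add_eq_zero]
    exact hB.skewSymmetric.inner_add_inner_eq_zero x y
  refine ⟨⟨x, LinearPMap.mem_adjoint_domain_of_exists _ ⟨_, h⟩⟩, rfl,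
    LinearPMap.adjoint_apply_eq hB.denselyDefined _ h, ?_⟩
  set z : A₀†.domain := ⟨x, LinearPMap.mem_adjoint_domain_of_exists _ ⟨_, h⟩⟩ with hz
  have hAz : A₀† z = -A₀ x := LinearPMap.adjoint_apply_eq hB.denselyDefined _ h
  have hgreen : ∀ b₁ b₂ : 𝓑, inner 𝕜 (B₁ z) b₂ + inner 𝕜 (B₂ z) b₁ = 0 := by
    intro b₁ b₂
    obtain ⟨y, hy⟩ := hB.surjective (b₁, b₂)
    obtain ⟨rfl, rfl⟩ := Prod.mk.inj hy
    rw [← hB.green, hAz, inner_neg_left,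
      (LinearPMap.adjoint_isFormalAdjoint hB.denselyDefined).symm x y, neg_add_cancel]
  constructor
  · simpa using hgreen 0 (B₁ z)
  · simpa using hgreen (B₂ z) 0

theorem IsBoundaryTriplet.dense_domain (hB : IsBoundaryTriplet A₀ B₁ B₂) (W₁ W₂ : 𝓑 →L[𝕜] K) :
    Dense ((boundaryRestriction A₀ B₁ B₂ W₁ W₂).domain : Set X) := by
  refine hB.denselyDefined.mono fun x hx => ?_
  obtain ⟨z, hz, -, h1, h2⟩ := hB.exists_eq_neg ⟨x, hx⟩
  refine (mem_boundaryRestriction_domain A₀ B₁ B₂ W₁ W₂ x).2 ?_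
  obtain rfl : (z : X) = x := hz
  exact ⟨z.2, by simp [h1, h2]⟩

theorem IsBoundaryTriplet.isClosed_boundaryRestriction (hB : IsBoundaryTriplet A₀ B₁ B₂)
    (W₁ W₂ : 𝓑 →L[𝕜] K) : (boundaryRestriction A₀ B₁ B₂ W₁ W₂).IsClosed := by
  refine IsSeqClosed.isClosed fun r p hr hp => ?_
  obtain ⟨x, y⟩ := p
  choose z hz hz1 hz2 using fun n =>
    (mem_boundaryRestriction_graph A₀ B₁ B₂ W₁ W₂ (r n).1 (r n).2).1 (hr n)
  have hx : Tendsto (fun n => (z n : X)) atTop (𝓝 x) := ((continuous_fst.tendsto _).comp hp).congr fun n => (hz1 n).symm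
  have hy : Tendsto (fun n => A₀† (z n)) atTop (𝓝 y) := ((continuous_snd.tendsto _).comp hp).congr fun n => (hz2 n).symm
  have hmem : (x, y) ∈ A₀†.graph :=
    (LinearPMap.adjoint_isClosed hB.denselyDefined).mem_of_tendsto (hx.prodMk_nhds hy)
      (Eventually.of_forall fun n => A₀†.mem_graph (z n))
  obtain ⟨w, hw1, hw2⟩ := A₀†.mem_graph_iff.1 hmem
  obtain rfl : (w : X) = x := hw1
  obtain rfl : A₀† w = y := hw2
  obtain ⟨C₁, hC₁⟩ := hB.bounded₁
  obtain ⟨C₂, hC₂⟩ := hB.bounded₂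
  refine (mem_boundaryRestriction_graph A₀ B₁ B₂ W₁ W₂ _ _).2 ⟨w, ?_, rfl, rfl⟩
  refine tendsto_nhds_unique (((W₁.continuous.tendsto _).comp
    (tendsto_of_le_graphNorm hC₁ hx hy)).add ((W₂.continuous.tendsto _).comp
    (tendsto_of_le_graphNorm hC₂ hx hy))) ?_
  simp only [Function.comp_def, hz]
  exact tendsto_const_nhds

/-- `l - A` has closed range when `A` is closed and dissipative, as it is bounded below. -/
theorem OpIsDissipative.isClosed_range {A : X →ₗ.[𝕜] X} (hA : OpIsDissipative A)
    (hc : A.IsClosed) {l : ℝ} (hl : 0 < l) :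
    IsClosed (((l : 𝕜) • A.domain.subtype - A.toFun).range : Set X) := by
  refine IsSeqClosed.isClosed fun r y hr hy => ?_
  choose u hu using hr
  replace hu : ∀ n, (l : 𝕜) • (u n : X) - A (u n) = r n := hu
  have hcauchy : CauchySeq fun n => (u n : X) := by
    rw [Metric.cauchySeq_iff']
    intro ε hε
    obtain ⟨N, hN⟩ := Metric.cauchySeq_iff'.1 hy.cauchySeq (l * ε) (mul_pos hl hε)
    refine ⟨N, fun n hn => ?_⟩
    have h1 := hA.mul_norm_le l (u n - u N)
    have h2 := hN n hn
    rw [dist_eq_norm] at h2 ⊢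
    rw [Submodule.coe_sub, A.map_sub, smul_sub, sub_sub_sub_comm, hu, hu] at h1
    exact lt_of_mul_lt_mul_left (h1.trans_lt h2) hl.le
  obtain ⟨x, hx⟩ := cauchySeq_tendsto_of_complete hcauchy
  have hAu : Tendsto (fun n => A (u n)) atTop (𝓝 ((l : 𝕜) • x - y)) :=
    ((hx.const_smul (l : 𝕜)).sub hy).congr fun n => by rw [← hu, sub_sub_cancel]
  have hmem : (x, (l : 𝕜) • x - y) ∈ A.graph :=
    hc.mem_of_tendsto (hx.prodMk_nhds hAu) (Eventually.of_forall fun n => A.mem_graph (u n))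
  obtain ⟨w, hw1, hw2⟩ := A.mem_graph_iff.1 hmem
  refine ⟨w, ?_⟩
  change (l : 𝕜) • (w : X) - A w = y
  rw [hw2, hw1, sub_sub_cancel]

/-- A vector orthogonal to the range of `l - A` is an eigenvector of `A₀†` for `-l`, since `A`
extends `-A₀`. Its boundary values satisfy the adjoint boundary condition, which makes
`Re ⟪y, A₀† y⟫` nonnegative, so it vanishes. -/
theorem IsBoundaryTriplet.eq_zero_of_orthogonal (hB : IsBoundaryTriplet A₀ B₁ B₂)
    {W₁ W₂ : 𝓑 →L[𝕜] K} (hW : Set.range (W₁ - W₂) ⊆ Set.range (W₁ + W₂))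
    (hcontr : ∀ b c, (W₁ + W₂) c = (W₁ - W₂) b → ‖c‖ ≤ ‖b‖) {l : ℝ} (hl : 0 < l) {y : X}
    (hy : ∀ x : A₀†.domain, W₁ (B₁ x) + W₂ (B₂ x) = 0 →
      inner 𝕜 ((l : 𝕜) • (x : X) - A₀† x) y = 0) : y = 0 := by
  have hform : ∀ x : A₀.domain, inner 𝕜 (-((l : 𝕜) • y)) (x : X) = inner 𝕜 y (A₀ x) := by
    intro x
    obtain ⟨z, hz, hAz, h1, h2⟩ := hB.exists_eq_neg x
    have h := hy z (by simp [h1, h2])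
    rw [hz, hAz, sub_neg_eq_add, ← inner_conj_symm, map_eq_zero, inner_add_right,
      inner_smul_right] at h
    rw [inner_neg_left, inner_smul_left, RCLike.conj_ofReal]
    exact neg_eq_iff_add_eq_zero.2 h
  obtain ⟨w, rfl⟩ : ∃ w : A₀†.domain, (w : X) = y :=
    ⟨⟨y, LinearPMap.mem_adjoint_domain_of_exists _ ⟨_, hform⟩⟩, rfl⟩
  have hAw : A₀† w = -((l : 𝕜) • (w : X)) :=
    LinearPMap.adjoint_apply_eq hB.denselyDefined _ hform
  have hbdry : ∀ b₁ b₂, W₁ b₁ + W₂ b₂ = 0 → inner 𝕜 b₁ (B₂ w) + inner 𝕜 b₂ (B₁ w) = 0 := by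
    intro b₁ b₂ hb
    obtain ⟨x, hx⟩ := hB.surjective (b₁, b₂)
    obtain ⟨rfl, rfl⟩ := Prod.mk.inj hx
    have h := hy x hb
    rw [inner_sub_left, inner_smul_left, RCLike.conj_ofReal, sub_eq_zero] at h
    rw [← hB.green, hAw, inner_neg_right, inner_smul_right, ← h, add_neg_cancel]
  have hle : ‖B₁ w - B₂ w‖ ≤ ‖B₁ w + B₂ w‖ := by
    set b := B₁ w - B₂ w with hb
    obtain ⟨c, hc⟩ := hW ⟨b, rfl⟩
    have h1 : W₁ (c - b) + W₂ (c + b) = 0 := by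
      rw [apply_sub_add_apply_add, hc, sub_self]
    have h2 : inner 𝕜 b b = -inner 𝕜 c (B₁ w + B₂ w) := by
      have h := hbdry _ _ h1
      rw [inner_sub_left, inner_add_left] at h
      rw [eq_neg_iff_add_eq_zero, ← h]
      nth_rw 2 [hb]
      rw [inner_sub_right, inner_add_right]
      ring
    rcases (norm_nonneg b).eq_or_lt with h0 | h0
    · rw [← h0]; exact norm_nonneg _
    refine le_of_mul_le_mul_left ?_ h0
    calc ‖b‖ * ‖b‖ = ‖inner 𝕜 b b‖ := by
          rw [inner_self_eq_norm_sq_to_K, norm_pow, RCLike.norm_ofReal, abs_norm, sq]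
      _ ≤ ‖c‖ * ‖B₁ w + B₂ w‖ := by rw [h2, norm_neg]; exact norm_inner_le_norm _ _
      _ ≤ _ := by gcongr; exact hcontr b c hc
  have hre := hB.re_inner_eq w
  rw [hAw, inner_neg_right, inner_smul_right, map_neg, RCLike.re_ofReal_mul,
    inner_self_eq_norm_sq] at hre
  have h4 := four_mul_re_inner (𝕜 := 𝕜) (B₁ w) (B₂ w)
  have h5 : ‖B₁ w - B₂ w‖ ^ 2 ≤ ‖B₁ w + B₂ w‖ ^ 2 := by gcongr
  have h6 : ‖(w : X)‖ ^ 2 ≤ 0 := by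
    by_contra hcon
    nlinarith [mul_pos hl (not_le.1 hcon)]
  exact norm_eq_zero.1 (pow_eq_zero_iff two_ne_zero |>.1 (le_antisymm h6 (sq_nonneg _)))

/-- The range condition of the Lumer–Phillips theorem for the boundary restriction: `l - A` has
closed range with trivial orthogonal complement. -/
theorem IsBoundaryTriplet.exists_smul_sub_eq (hB : IsBoundaryTriplet A₀ B₁ B₂)
    {W₁ W₂ : 𝓑 →L[𝕜] K} (hW : Set.range (W₁ - W₂) ⊆ Set.range (W₁ + W₂))
    (hA : OpIsDissipative (boundaryRestriction A₀ B₁ B₂ W₁ W₂)) {l : ℝ} (hl : 0 < l) (y : X) :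
    ∃ x : (boundaryRestriction A₀ B₁ B₂ W₁ W₂).domain,
      (l : 𝕜) • (x : X) - boundaryRestriction A₀ B₁ B₂ W₁ W₂ x = y := by
  set A := boundaryRestriction A₀ B₁ B₂ W₁ W₂ with hAdef
  set R : Submodule 𝕜 X := ((l : 𝕜) • A.domain.subtype - A.toFun).range with hR
  have hclosed : IsClosed (R : Set X) :=
    hA.isClosed_range (hB.isClosed_boundaryRestriction W₁ W₂) hl
  have : CompleteSpace R := hclosed.completeSpace_coe
  have horth : Rᗮ = ⊥ := by
    refine (Submodule.eq_bot_iff _).2 fun v hv => ?_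
    refine hB.eq_zero_of_orthogonal hW ((forall_re_inner_nonpos_iff W₁ W₂).1
      ((hB.opIsDissipative_iff W₁ W₂).1 hA)) hl fun x hx => ?_
    obtain ⟨z, hz1, hz2⟩ := LinearPMap.mem_graph_iff _ |>.1
      ((mem_boundaryRestriction_graph A₀ B₁ B₂ W₁ W₂ _ _).2 ⟨x, hx, rfl, rfl⟩)
    simp only at hz1 hz2
    rw [← hz1, ← hz2]
    exact (Submodule.mem_orthogonal _ _).1 hv _ ⟨z, rfl⟩
  have hmem : y ∈ R := (Submodule.orthogonal_eq_bot_iff.1 horth) ▸ Submodule.mem_top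
  obtain ⟨x, hx⟩ := hmem
  exact ⟨x, hx⟩

end BoundaryRestriction

theorem mainTheorem7 {𝕜 X 𝓑 K : Type*} [RCLike 𝕜]
    [NormedAddCommGroup X] [InnerProductSpace 𝕜 X] [CompleteSpace X]
    [NormedAddCommGroup 𝓑] [InnerProductSpace 𝕜 𝓑] [CompleteSpace 𝓑]
    [NormedAddCommGroup K] [InnerProductSpace 𝕜 K] [CompleteSpace K]
    (A₀ : X →ₗ.[𝕜] X) (B₁ B₂ : A₀†.domain →ₗ[𝕜] 𝓑) (hB : IsBoundaryTriplet A₀ B₁ B₂)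
    (W₁ W₂ : 𝓑 →L[𝕜] K) (hW : Set.range (W₁ - W₂) ⊆ Set.range (W₁ + W₂)) :
    [GeneratesContractionSemigroup (boundaryRestriction A₀ B₁ B₂ W₁ W₂),
      OpIsDissipative (boundaryRestriction A₀ B₁ B₂ W₁ W₂),
      Function.Injective (W₁ + W₂) ∧
        (W₁ ∘L ContinuousLinearMap.adjoint W₂ +
          W₂ ∘L ContinuousLinearMap.adjoint W₁).IsPositive].TFAE := by
  tfae_have 1 → 2 := GeneratesContractionSemigroup.opIsDissipative
  tfae_have 2 → 1 := fun h => h.generatesContractionSemigroup (hB.dense_domain W₁ W₂)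
    fun l hl => hB.exists_smul_sub_eq hW h hl
  tfae_have 2 ↔ 3 := (hB.opIsDissipative_iff W₁ W₂).trans
    ((forall_re_inner_nonpos_iff W₁ W₂).trans (forall_norm_le_iff W₁ W₂ hW))
  tfae_finish
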